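/- Let $Q^{(1)}=A_1B_1C_1D_1$ be a quadrilateral in the plane (convex, concave or self-intersecting), no three of whose vertices are collinear and whose four vertices do not lie on one circle. For a quadrilateral $ABCD$ its triad circles are the circumcircles $o_1=(DAB)$, $o_2=(ABC)$, $o_3=(BCD)$, $o_4=(CDA)$. Let $Q^{(n+1)}=A_{n+1}B_{n+1}C_{n+1}D_{n+1}$ be the quadrilateral whose vertices are, in this order, the centers of the triad circles $o_1^{(n)},o_2^{(n)},o_3^{(n)},o_4^{(n)}$ of $Q^{(n)}$ ($n\ge 1$). For circles $o,o'$ with centers $O,O'$ and radii $R,R'$, the circle of similitude $CS(o,o')$ is the set of points $P$ with $|PO|/|PO'|=R/R'$; the point $\infty$ is counted as belonging to it exactly when $R=R'$. A spiral similarity centered at a point $w$ of the plane is a map $z\mapsto w+c(z-w)$ with $c\in\mathbb C\setminus\{0\}$; a spiral similarity centered at $\infty$ means a translation. Then every $Q^{(n)}$ again has no three collinear vertices and is not cyclic, and in the plane extended by $\infty$ the circles of similitude $CS(o_1^{(1)},o_2^{(1)})$ and $CS(o_1^{(1)},o_4^{(1)})$ have exactly one common point $W$ different from $A_1$. A point $w$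 of the plane equals $W$ if and only if it is the common center of the similarities of the iterative process, that is, there is a real $r\neq 1$ such that for all $n\ge1$ the map $z\mapsto w+r(z-w)$ takes the vertices of $Q^{(n)}$ to the corresponding vertices of $Q^{(n+2)}$. Moreover, for all $i,j\in\{1,2,3,4\}$ and all generations $k,l\ge 1$, $$W\in CS\bigl(o_i^{(k)},o_j^{(l)}\bigr),$$ and there is a spiral similarity centered at $W$ that takes $o_i^{(k)}$ onto $o_j^{(l)}$. -/

import Mathlib

/-- The three vertices `Q (i-1)`, `Q i`, `Q (i+1)` (indices mod 4) of the `i`-th triad triangle of the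
quadrilateral with consecutive vertices `A = Q 0`, `B = Q 1`, `C = Q 2`, `D = Q 3`. -/
def triad (Q : Fin 4 → ℂ) (i : Fin 4) : Fin 3 → ℂ :=
  ![Q (i - 1), Q i, Q (i + 1)]

/-- Four points of the plane, no three of them collinear and not all four on one circle.  The
quadrilateral `ABCD` may be convex, concave or self-intersecting. -/
def IsNoncyclicQuadrilateral (Q : Fin 4 → ℂ) : Prop :=
  (∀ i, AffineIndependent ℝ (triad Q i)) ∧ ¬ EuclideanGeometry.Cospherical (Set.range Q)

open Classical in
/-- The `i`-th triad circle: the circumcircle of the `i`-th triad triangle, so that `o₁ = (DAB)`,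
`o₂ = (ABC)`, `o₃ = (BCD)`, `o₄ = (CDA)` are the values at `0, 1, 2, 3`.  (The value for collinear
triples is a dummy.) -/
noncomputable def triadCircle (Q : Fin 4 → ℂ) (i : Fin 4) : EuclideanGeometry.Sphere ℂ :=
  if h : AffineIndependent ℝ (triad Q i) then
    (⟨triad Q i, h⟩ : Affine.Simplex ℝ ℂ 2).circumsphere
  else ⟨Q i, 0⟩

/-- The perpendicular bisector construction: the new vertices are the circumcenters of the triad
triangles. -/
noncomputable def nextQuadrilateral (Q : Fin 4 → ℂ) : Fin 4 → ℂ :=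
  fun i => (triadCircle Q i).center

/-- The generations of the iterative process, counted from `0`: `generation Q 0 = Q` is the first
generation `Q⁽¹⁾`, and `generation Q n` is `Q⁽ⁿ⁺¹⁾`. -/
noncomputable def generation (Q : Fin 4 → ℂ) (n : ℕ) : Fin 4 → ℂ :=
  nextQuadrilateral^[n] Q

/-- The circle of similitude of two circles, in the inversive plane `ℂ ∪ {∞}`: the points whose
distances to the centers are in the ratio of the radii.  The point `∞` belongs to it exactly when the
radii are equal, that is, when the locus is a line. -/
def circleOfSimilitude (s t : EuclideanGeometry.Sphere ℂ) : Set (OnePoint ℂ) :=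
  {P | (∃ z : ℂ, P = (z : OnePoint ℂ) ∧
          dist z s.center / dist z t.center = s.radius / t.radius) ∨
       (P = OnePoint.infty ∧ s.radius = t.radius)}

/-- `W` is the second point of intersection, other than the vertex `A`, of the circles of similitude
`CS(o₁, o₂)` and `CS(o₁, o₄)`. -/
def IsSecondIntersection (Q : Fin 4 → ℂ) (W : OnePoint ℂ) : Prop :=
  W ≠ (Q 0 : OnePoint ℂ) ∧
  W ∈ circleOfSimilitude (triadCircle Q 0) (triadCircle Q 1) ∧
  W ∈ circleOfSimilitude (triadCircle Q 0) (triadCircle Q 3)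

/-- The spiral similarity with center `w`, ratio `‖c‖` and rotation angle `arg c`. -/
def spiralSimilarity (w c : ℂ) : ℂ → ℂ :=
  fun z => w + c * (z - w)

/-- `W` is the center of a spiral similarity taking the circle `s` onto the circle `t`.  Spiral
similarities centered at `∞` are, by convention, the translations. -/
def IsSpiralCenter (W : OnePoint ℂ) (s t : EuclideanGeometry.Sphere ℂ) : Prop :=
  (∃ w c : ℂ, W = (w : OnePoint ℂ) ∧ c ≠ 0 ∧
      spiralSimilarity w c '' (s : Set ℂ) = (t : Set ℂ)) ∨
  (W = OnePoint.infty ∧ ∃ v : ℂ, (fun z => z + v) '' (s : Set ℂ) = (t : Set ℂ))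

/-!
Consecutive triad circles share an edge of the quadrilateral, so each edge of `nextQuadrilateral Q`
is the corresponding edge of `Q` turned by a right angle and scaled by a real factor. The product
of the factors of opposite edges does not depend on the pair, hence `Q` and the quadrilateral two
generations later are related by a map `z ↦ r * z + v` with `r` real, and `r` and `v` are the same
in all generations.

The center `o` and the radius `R` of every triad circle satisfy
`‖v - (1 - r) * o‖ ^ 2 = r * (r - 1) * R ^ 2`. If `r ≠ 1`, the distances from the fixed point
`v / (1 - r)` to the centers are therefore proportional to the radii, for all triad circles of all
generations at once, which puts this point on all circles of similitude. If `r = 1`, all the radii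
agree and the point at infinity takes its place.

Uniqueness: three circles through a point `a` have as radii the distances from `a` to their centers.
If the centers are not collinear, at most one point of the extended plane besides `a` has distances
to them proportional to those from `a` (equal radii standing for the point at infinity), because
the difference of the squared distances from two points is an affine function of the center.
-/

section

open EuclideanGeometry
open scoped ComplexConjugate RealInnerProductSpace

/-- Twice the signed area of the triangle `abc`, as the cross product of consecutive edges. -/
def signedArea (a b c : ℂ) : ℝ :=
  (conj (b - a) * (c - b)).im

/-- The imaginary part of the cross-ratio `(b - a) (d - c) / ((c - b) (a - d))`, cleared of its
denominator.  It measures how far four points are from being concyclic or collinear. -/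
def cyclicDefect (a b c d : ℂ) : ℝ :=
  ((b - a) * (d - c) * conj ((c - b) * (a - d))).im

theorem signedArea_rotate (a b c : ℂ) : signedArea b c a = signedArea a b c := by
  simp only [signedArea, Complex.mul_im, Complex.conj_re, Complex.conj_im, Complex.sub_re,
    Complex.sub_im]
  ring

theorem cyclicDefect_rotate (a b c d : ℂ) : cyclicDefect b c d a = -cyclicDefect a b c d := by
  simp only [cyclicDefect, ← Complex.conj_im]
  congr 1
  simp only [map_mul, Complex.conj_conj]
  ring

theorem affineIndependent_iff_signedArea_ne_zero {a b c : ℂ} :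
    AffineIndependent ℝ ![a, b, c] ↔ signedArea a b c ≠ 0 := by
  rw [← not_iff_not, not_ne_iff, ← collinear_iff_not_affineIndependent_set]
  constructor
  · rw [collinear_iff_of_mem (Set.mem_insert a _)]
    rintro ⟨v, hv⟩
    obtain ⟨r, rfl⟩ := hv b (by simp)
    obtain ⟨t, rfl⟩ := hv c (by simp)
    simp only [signedArea, vadd_eq_add, Complex.real_smul, Complex.mul_im, Complex.mul_re,
      Complex.conj_re, Complex.conj_im, Complex.sub_re, Complex.sub_im, Complex.add_re,
      Complex.add_im, Complex.ofReal_re, Complex.ofReal_im]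
    ring
  · intro h
    rcases eq_or_ne a b with rfl | hab
    · simpa using collinear_pair ℝ a c
    have him : ((c - b) / (b - a)).im = 0 := by
      rw [signedArea, mul_comm] at h
      rw [div_eq_mul_inv, Complex.inv_def, ← mul_assoc, Complex.im_mul_ofReal, h, zero_mul]
    have hre : (((c - b) / (b - a)).re : ℂ) = (c - b) / (b - a) := Complex.ext rfl him.symm
    have hc : c = ((c - b) / (b - a)).re • (b - a) + b := by
      rw [Complex.real_smul, hre, div_mul_cancel₀ _ (sub_ne_zero.2 hab.symm), sub_add_cancel]
    rw [collinear_iff_of_mem (p₀ := b) (by simp)]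
    refine ⟨b - a, fun p hp => ?_⟩
    rcases hp with rfl | rfl | rfl
    exacts [⟨-1, by simp⟩, ⟨0, by simp⟩, ⟨_, hc⟩]

theorem two_mul_inner_of_mem_sphere {V P : Type*} [NormedAddCommGroup V] [InnerProductSpace ℝ V]
    [MetricSpace P] [NormedAddTorsor V P] {s : Sphere P} {a b : P} (ha : a ∈ s) (hb : b ∈ s) :
    2 * ⟪s.center -ᵥ a, b -ᵥ a⟫ = ‖b -ᵥ a‖ ^ 2 := by
  have h : ‖(b -ᵥ a) - (s.center -ᵥ a)‖ ^ 2 = ‖s.center -ᵥ a‖ ^ 2 := by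
    rw [vsub_sub_vsub_cancel_right, ← dist_eq_norm_vsub, ← dist_eq_norm_vsub,
      mem_sphere.1 hb, mem_sphere'.1 ha]
  rw [norm_sub_sq_real, real_inner_comm] at h
  linarith

theorem two_signedArea_mul_center_sub {s : Sphere ℂ} {a b c : ℂ} (ha : a ∈ s) (hb : b ∈ s)
    (hc : c ∈ s) :
    2 * signedArea a b c * (s.center - a) = Complex.I * ((b - a) * (c - a) * conj (c - b)) := by
  have hb' := two_mul_inner_of_mem_sphere ha hb
  have hc' := two_mul_inner_of_mem_sphere ha hc
  simp only [vsub_eq_sub, Complex.inner, Complex.sq_norm, Complex.normSq_apply, Complex.mul_re,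
    Complex.conj_re, Complex.conj_im, Complex.sub_re, Complex.sub_im] at hb' hc'
  apply Complex.ext
  all_goals simp only [signedArea, map_sub, Complex.mul_re, Complex.mul_im, Complex.conj_re,
    Complex.conj_im, Complex.sub_re, Complex.sub_im, Complex.ofReal_re, Complex.ofReal_im,
    Complex.I_re, Complex.I_im, Complex.re_ofNat, Complex.im_ofNat]
  · linear_combination (c.im - a.im) * hb' - (b.im - a.im) * hc'
  · linear_combination (a.re - c.re) * hb' + (b.re - a.re) * hc'

theorem power_eq_of_mem_sphere {V P : Type*} [NormedAddCommGroup V] [InnerProductSpace ℝ V]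
    [MetricSpace P] [NormedAddTorsor V P] {s : Sphere P} {a : P} (ha : a ∈ s) (d : P) :
    s.power d = ‖d -ᵥ a‖ ^ 2 - 2 * ⟪s.center -ᵥ a, d -ᵥ a⟫ := by
  rw [Sphere.power, ← mem_sphere'.1 ha, dist_eq_norm_vsub, dist_eq_norm_vsub,
      ← vsub_sub_vsub_cancel_right d s.center a, norm_sub_sq_real, real_inner_comm]
  ring

theorem signedArea_mul_power {s : Sphere ℂ} {a b c : ℂ} (ha : a ∈ s) (hb : b ∈ s) (hc : c ∈ s)
    (d : ℂ) : signedArea a b c * s.power d = cyclicDefect a b c d := by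
  have h := two_signedArea_mul_center_sub ha hb hc
  have hre := congrArg Complex.re h
  have him := congrArg Complex.im h
  rw [power_eq_of_mem_sphere ha]
  simp only [signedArea, cyclicDefect, vsub_eq_sub, Complex.normSq_apply, Complex.sq_norm,
    Complex.inner, map_sub, map_mul, Complex.mul_re, Complex.mul_im, Complex.conj_re,
    Complex.conj_im, Complex.sub_re, Complex.sub_im, Complex.ofReal_re, Complex.ofReal_im,
    Complex.I_re, Complex.I_im, Complex.re_ofNat, Complex.im_ofNat] at hre him ⊢
  linear_combination -(d.re - a.re) * hre - (d.im - a.im) * him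

theorem two_signedArea_mul_signedArea_mul_center_sub_center {s t : Sphere ℂ} {a b c d : ℂ}
    (hds : d ∈ s) (has : a ∈ s) (hbs : b ∈ s) (hat : a ∈ t) (hbt : b ∈ t) (hct : c ∈ t) :
    2 * signedArea d a b * signedArea a b c * (t.center - s.center) =
      Complex.I * cyclicDefect d a b c * (b - a) := by
  have hs := two_signedArea_mul_center_sub has hbs hds
  have ht := two_signedArea_mul_center_sub hat hbt hct
  rw [signedArea_rotate] at hs
  have key : (signedArea d a b * ((c - a) * conj (c - b)) -
      signedArea a b c * ((d - a) * conj (d - b)) : ℂ) = cyclicDefect d a b c := by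
    apply Complex.ext <;>
    · simp only [signedArea, cyclicDefect, map_sub, map_mul, Complex.mul_re, Complex.mul_im,
        Complex.conj_re, Complex.conj_im, Complex.sub_re, Complex.sub_im, Complex.ofReal_re,
        Complex.ofReal_im]
      ring
  linear_combination (signedArea d a b : ℂ) * ht - signedArea a b c * hs +
    Complex.I * (b - a) * key

theorem signedArea_mul_sub_eq_add (a b c d : ℂ) :
    signedArea d a b * (c - a) = signedArea c d a * (b - a) + signedArea a b c * (d - a) := by
  apply Complex.ext <;>
  · simp only [signedArea, Complex.add_re, Complex.add_im, Complex.mul_re, Complex.mul_im,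
      Complex.conj_re, Complex.conj_im, Complex.sub_re, Complex.sub_im, Complex.ofReal_re,
      Complex.ofReal_im]
    ring

theorem signedArea_mul_signedArea_mul_norm_sq_sub (a b c d : ℂ) :
    signedArea d a b * signedArea b c d * ‖c - a‖ ^ 2 -
      signedArea a b c * signedArea c d a * ‖d - b‖ ^ 2 =
    cyclicDefect d a b c * (signedArea a b c + signedArea c d a) := by
  simp only [signedArea, cyclicDefect, Complex.sq_norm, Complex.normSq_apply, map_sub, map_mul,
    Complex.mul_re, Complex.mul_im, Complex.conj_re, Complex.conj_im, Complex.sub_re,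
    Complex.sub_im]
  ring

theorem eq_apply_zero_of_apply_add_one {α : Type*} {n : ℕ} {f : Fin (n + 1) → α}
    (h : ∀ i, f (i + 1) = f i) (i : Fin (n + 1)) : f i = f 0 := by
  induction i using Fin.induction with
  | zero => rfl
  | succ i ih => rw [← Fin.coeSucc_eq_succ, h, ih]

theorem fin_four_add_one_add_one (i : Fin 4) : i + 1 + 1 = i + 2 :=
  add_assoc i 1 1

theorem fin_four_add_two_add_one (i : Fin 4) : i + 2 + 1 = i - 1 := by
  decide +revert

theorem fin_four_add_one_add_two (i : Fin 4) : i + 1 + 2 = i - 1 := by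
  decide +revert

/-- Twice the signed area of the `i`-th triad triangle. -/
def triadArea (Q : Fin 4 → ℂ) (i : Fin 4) : ℝ :=
  signedArea (Q (i - 1)) (Q i) (Q (i + 1))

/-- The cyclic defect of a quadrilateral, its vertices being listed from the `i - 1`-st on; up to
sign it does not depend on `i`. -/
def quadDefect (Q : Fin 4 → ℂ) (i : Fin 4) : ℝ :=
  cyclicDefect (Q (i - 1)) (Q i) (Q (i + 1)) (Q (i + 2))

/-- The `i`-th edge of the quadrilateral of triad centers is the `i`-th edge of `Q` turned by a
right angle and scaled by this (signed) factor. -/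
noncomputable def edgeRatio (Q : Fin 4 → ℂ) (i : Fin 4) : ℝ :=
  quadDefect Q i / (2 * triadArea Q i * triadArea Q (i + 1))

/-- The ratio of the homothety that takes `Q` to the quadrilateral two generations later. -/
noncomputable def homothetyRatio (Q : Fin 4 → ℂ) : ℝ :=
  -(edgeRatio Q 0 * edgeRatio Q 2)

/-- The constant term of the homothety that takes `Q` to the quadrilateral two generations later,
written as `z ↦ r * z + v` so that translations are included. -/
noncomputable def homothetyShift (Q : Fin 4 → ℂ) : ℂ :=
  nextQuadrilateral (nextQuadrilateral Q) 0 - homothetyRatio Q * Q 0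

section Quadrilateral

variable {Q : Fin 4 → ℂ}

theorem generation_succ (n : ℕ) : generation Q (n + 1) = nextQuadrilateral (generation Q n) :=
  Function.iterate_succ_apply' _ n Q

theorem triadArea_add_one (i : Fin 4) :
    triadArea Q (i + 1) = signedArea (Q i) (Q (i + 1)) (Q (i + 2)) := by
  fin_cases i <;> rfl

theorem triadArea_add_two (i : Fin 4) :
    triadArea Q (i + 2) = signedArea (Q (i + 1)) (Q (i + 2)) (Q (i - 1)) := by
  fin_cases i <;> rfl

theorem triadArea_sub_one (i : Fin 4) :
    triadArea Q (i - 1) = signedArea (Q (i + 2)) (Q (i - 1)) (Q i) := by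
  fin_cases i <;> rfl

theorem quadDefect_add_one (i : Fin 4) : quadDefect Q (i + 1) = -quadDefect Q i := by
  rw [quadDefect, quadDefect, ← cyclicDefect_rotate]
  fin_cases i <;> rfl

theorem quadDefect_add_two (i : Fin 4) : quadDefect Q (i + 2) = quadDefect Q i := by
  rw [← fin_four_add_one_add_one, quadDefect_add_one, quadDefect_add_one, neg_neg]

theorem quadDefect_sub_one (i : Fin 4) : quadDefect Q (i - 1) = -quadDefect Q i := by
  rw [← fin_four_add_two_add_one, quadDefect_add_one, quadDefect_add_two]

theorem affineIndependent_triad_iff {i : Fin 4} :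
    AffineIndependent ℝ (triad Q i) ↔ triadArea Q i ≠ 0 :=
  affineIndependent_iff_signedArea_ne_zero

section TriadCircle

variable {i : Fin 4} (h : AffineIndependent ℝ (triad Q i))
include h

theorem triad_mem_triadCircle (j : Fin 3) : triad Q i j ∈ triadCircle Q i := by
  rw [triadCircle, dif_pos h]
  exact Affine.Simplex.mem_circumsphere _ j

theorem sub_one_mem_triadCircle : Q (i - 1) ∈ triadCircle Q i :=
  triad_mem_triadCircle h 0

theorem self_mem_triadCircle : Q i ∈ triadCircle Q i :=
  triad_mem_triadCircle h 1

theorem add_one_mem_triadCircle : Q (i + 1) ∈ triadCircle Q i :=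
  triad_mem_triadCircle h 2

theorem triadCircle_radius_pos : 0 < (triadCircle Q i).radius := by
  rw [triadCircle, dif_pos h]
  exact Affine.Simplex.circumradius_pos _

theorem eq_triadCircle {s : Sphere ℂ} (hs : ∀ j, triad Q i j ∈ s) : s = triadCircle Q i := by
  have htop : affineSpan ℝ (Set.range (triad Q i)) = ⊤ := by
    rw [h.affineSpan_eq_top_iff_card_eq_finrank_add_one, Complex.finrank_real_complex,
      Fintype.card_fin]
  rw [triadCircle, dif_pos h]
  refine (Affine.Simplex.circumsphere_unique_dist_eq _).2 s ⟨?_, Set.range_subset_iff.2 hs⟩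
  exact htop ▸ AffineSubspace.mem_top _ _ _

theorem cospherical_range_iff : Cospherical (Set.range Q) ↔ quadDefect Q i = 0 := by
  have hpow : triadArea Q i * (triadCircle Q i).power (Q (i + 2)) = quadDefect Q i :=
    signedArea_mul_power (sub_one_mem_triadCircle h) (self_mem_triadCircle h)
      (add_one_mem_triadCircle h) _
  rw [← hpow, mul_eq_zero, or_iff_right (affineIndependent_triad_iff.1 h),
    Sphere.power_eq_zero_iff_mem_sphere (triadCircle_radius_pos h).le,
    cospherical_iff_exists_sphere]
  constructor
  · rintro ⟨s, hs⟩
    rw [← eq_triadCircle h fun j => by fin_cases j <;> exact hs (Set.mem_range_self _)]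
    exact hs (Set.mem_range_self _)
  · refine fun hmem => ⟨triadCircle Q i, Set.range_subset_iff.2 fun j => ?_⟩
    have hcases : ∀ i j : Fin 4, j = i - 1 ∨ j = i ∨ j = i + 1 ∨ j = i + 2 := by decide
    rcases hcases i j with rfl | rfl | rfl | rfl
    exacts [sub_one_mem_triadCircle h, self_mem_triadCircle h, add_one_mem_triadCircle h, hmem]

end TriadCircle

theorem isNoncyclicQuadrilateral_iff :
    IsNoncyclicQuadrilateral Q ↔ (∀ i, triadArea Q i ≠ 0) ∧ ∀ i, quadDefect Q i ≠ 0 := by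
  simp only [IsNoncyclicQuadrilateral, ← affineIndependent_triad_iff]
  refine and_congr_right fun h => ?_
  exact ⟨fun hQ i => mt (cospherical_range_iff (h i)).2 hQ,
    fun hQ => mt (cospherical_range_iff (h 0)).1 (hQ 0)⟩

theorem edgeRatio_mul_edgeRatio_add_two (i : Fin 4) :
    edgeRatio Q i * edgeRatio Q (i + 2) = -homothetyRatio Q := by
  have step (i : Fin 4) :
      edgeRatio Q (i + 1) * edgeRatio Q (i + 1 + 2) = edgeRatio Q i * edgeRatio Q (i + 2) := by
    simp only [edgeRatio, sub_add_cancel, fin_four_add_one_add_two, fin_four_add_one_add_one,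
      fin_four_add_two_add_one, quadDefect_add_one, quadDefect_add_two, quadDefect_sub_one]
    ring
  rw [homothetyRatio, neg_neg]
  exact eq_apply_zero_of_apply_add_one (f := fun i => edgeRatio Q i * edgeRatio Q (i + 2)) step i

end Quadrilateral

namespace IsNoncyclicQuadrilateral

variable {Q : Fin 4 → ℂ} (hQ : IsNoncyclicQuadrilateral Q)
include hQ

theorem triadArea_ne_zero (i : Fin 4) : triadArea Q i ≠ 0 :=
  (isNoncyclicQuadrilateral_iff.1 hQ).1 i

theorem edgeRatio_ne_zero (i : Fin 4) : edgeRatio Q i ≠ 0 :=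
  div_ne_zero ((isNoncyclicQuadrilateral_iff.1 hQ).2 i)
    (mul_ne_zero (mul_ne_zero two_ne_zero (hQ.triadArea_ne_zero i)) (hQ.triadArea_ne_zero _))

theorem homothetyRatio_ne_zero : homothetyRatio Q ≠ 0 :=
  neg_ne_zero.2 (mul_ne_zero (hQ.edgeRatio_ne_zero 0) (hQ.edgeRatio_ne_zero 2))

theorem nextQuadrilateral_add_one_sub (i : Fin 4) :
    nextQuadrilateral Q (i + 1) - nextQuadrilateral Q i =
      Complex.I * edgeRatio Q i * (Q (i + 1) - Q i) := by
  have hi : (triadArea Q i : ℂ) ≠ 0 := Complex.ofReal_ne_zero.2 (hQ.triadArea_ne_zero i)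
  have hi' : (triadArea Q (i + 1) : ℂ) ≠ 0 := Complex.ofReal_ne_zero.2 (hQ.triadArea_ne_zero _)
  have hmem := self_mem_triadCircle (hQ.1 (i + 1))
  have hpred := sub_one_mem_triadCircle (hQ.1 (i + 1))
  have hsucc := add_one_mem_triadCircle (hQ.1 (i + 1))
  rw [add_sub_cancel_right] at hpred
  rw [fin_four_add_one_add_one] at hsucc
  have h := two_signedArea_mul_signedArea_mul_center_sub_center
    (sub_one_mem_triadCircle (hQ.1 i)) (self_mem_triadCircle (hQ.1 i))
    (add_one_mem_triadCircle (hQ.1 i)) hpred hmem hsucc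
  change 2 * (triadArea Q i : ℂ) * signedArea (Q i) (Q (i + 1)) (Q (i + 2)) *
    (nextQuadrilateral Q (i + 1) - nextQuadrilateral Q i) =
    Complex.I * quadDefect Q i * (Q (i + 1) - Q i) at h
  rw [← triadArea_add_one] at h
  rw [edgeRatio]
  push_cast
  field_simp
  linear_combination h

theorem nextQuadrilateral_sub_sub_one (i : Fin 4) :
    nextQuadrilateral Q i - nextQuadrilateral Q (i - 1) =
      Complex.I * edgeRatio Q (i - 1) * (Q i - Q (i - 1)) := by
  have h := hQ.nextQuadrilateral_add_one_sub (i - 1)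
  rwa [sub_add_cancel] at h

theorem triadArea_nextQuadrilateral (i : Fin 4) :
    triadArea (nextQuadrilateral Q) i = edgeRatio Q (i - 1) * edgeRatio Q i * triadArea Q i := by
  rw [triadArea, triadArea, signedArea, signedArea, hQ.nextQuadrilateral_add_one_sub,
    hQ.nextQuadrilateral_sub_sub_one, ← Complex.im_ofReal_mul]
  congr 1
  simp only [map_mul, Complex.conj_I, Complex.conj_ofReal, Complex.ofReal_mul]
  linear_combination (-edgeRatio Q (i - 1) * edgeRatio Q i * conj (Q i - Q (i - 1)) *
    (Q (i + 1) - Q i) : ℂ) * Complex.I_sq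

theorem quadDefect_nextQuadrilateral (i : Fin 4) :
    quadDefect (nextQuadrilateral Q) i =
      edgeRatio Q (i - 1) * edgeRatio Q i * edgeRatio Q (i + 1) * edgeRatio Q (i + 2) *
        quadDefect Q i := by
  have h₁ := hQ.nextQuadrilateral_add_one_sub (i + 1)
  have h₂ := hQ.nextQuadrilateral_add_one_sub (i + 2)
  rw [fin_four_add_one_add_one] at h₁
  rw [fin_four_add_two_add_one] at h₂
  rw [quadDefect, quadDefect, cyclicDefect, cyclicDefect, hQ.nextQuadrilateral_add_one_sub,
    hQ.nextQuadrilateral_sub_sub_one, h₁, h₂, ← Complex.im_ofReal_mul]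
  congr 1
  simp only [map_mul, Complex.conj_I, Complex.conj_ofReal, Complex.ofReal_mul]
  linear_combination (edgeRatio Q (i - 1) * edgeRatio Q i * edgeRatio Q (i + 1) *
    edgeRatio Q (i + 2) * (Q i - Q (i - 1)) * (Q (i + 2) - Q (i + 1)) *
    (conj (Q (i + 1) - Q i) * conj (Q (i - 1) - Q (i + 2))) : ℂ) * Complex.I_pow_four

protected theorem nextQuadrilateral : IsNoncyclicQuadrilateral (nextQuadrilateral Q) := by
  refine isNoncyclicQuadrilateral_iff.2 ⟨fun i => ?_, fun i => ?_⟩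
  · rw [hQ.triadArea_nextQuadrilateral]
    exact mul_ne_zero (mul_ne_zero (hQ.edgeRatio_ne_zero _) (hQ.edgeRatio_ne_zero _))
      (hQ.triadArea_ne_zero i)
  · rw [hQ.quadDefect_nextQuadrilateral]
    exact mul_ne_zero (mul_ne_zero (mul_ne_zero (mul_ne_zero (hQ.edgeRatio_ne_zero _)
      (hQ.edgeRatio_ne_zero _)) (hQ.edgeRatio_ne_zero _)) (hQ.edgeRatio_ne_zero _))
      ((isNoncyclicQuadrilateral_iff.1 hQ).2 i)

protected theorem generation (n : ℕ) : IsNoncyclicQuadrilateral (generation Q n) := by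
  induction n with
  | zero => exact hQ
  | succ n ih =>
    rw [generation_succ]
    exact ih.nextQuadrilateral

theorem edgeRatio_nextQuadrilateral (i : Fin 4) :
    edgeRatio (nextQuadrilateral Q) i = edgeRatio Q (i + 2) := by
  have hi := hQ.edgeRatio_ne_zero i
  have hi₁ := hQ.edgeRatio_ne_zero (i + 1)
  have hi₃ := hQ.edgeRatio_ne_zero (i - 1)
  rw [edgeRatio, hQ.quadDefect_nextQuadrilateral, hQ.triadArea_nextQuadrilateral,
    hQ.triadArea_nextQuadrilateral, add_sub_cancel_right]
  have hD : quadDefect Q i = edgeRatio Q i * (2 * triadArea Q i * triadArea Q (i + 1)) :=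
    (div_mul_cancel₀ _ (mul_ne_zero (mul_ne_zero two_ne_zero (hQ.triadArea_ne_zero i))
      (hQ.triadArea_ne_zero _))).symm
  have hS := hQ.triadArea_ne_zero i
  have hS' := hQ.triadArea_ne_zero (i + 1)
  rw [hD]
  field_simp

theorem homothetyRatio_nextQuadrilateral :
    homothetyRatio (nextQuadrilateral Q) = homothetyRatio Q := by
  rw [homothetyRatio, homothetyRatio, hQ.edgeRatio_nextQuadrilateral,
    hQ.edgeRatio_nextQuadrilateral, mul_comm]
  rfl

theorem nextQuadrilateral_nextQuadrilateral (i : Fin 4) :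
    nextQuadrilateral (nextQuadrilateral Q) i =
      homothetyRatio Q * Q i + homothetyShift Q := by
  have hr (i : Fin 4) : (edgeRatio Q i * edgeRatio Q (i + 2) : ℂ) = -homothetyRatio Q :=
    mod_cast edgeRatio_mul_edgeRatio_add_two i
  rw [homothetyShift, ← sub_eq_iff_eq_add']
  refine eq_apply_zero_of_apply_add_one (f := fun i =>
    nextQuadrilateral (nextQuadrilateral Q) i - homothetyRatio Q * Q i)
    (fun i => ?_) i
  have h := hQ.nextQuadrilateral.nextQuadrilateral_add_one_sub i
  rw [hQ.nextQuadrilateral_add_one_sub, hQ.edgeRatio_nextQuadrilateral] at h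
  linear_combination h + (edgeRatio Q i * edgeRatio Q (i + 2) * (Q (i + 1) - Q i)) *
    Complex.I_sq - (Q (i + 1) - Q i) * hr i

theorem homothetyRatio_mul_triadArea_mul_triadArea (i : Fin 4) :
    homothetyRatio Q * (triadArea Q i * triadArea Q (i + 2)) =
      -(quadDefect Q i / (2 * triadArea Q (i + 1) * triadArea Q (i - 1))) ^ 2 *
        (triadArea Q (i + 1) * triadArea Q (i - 1)) := by
  have h₀ := hQ.triadArea_ne_zero i
  have h₁ := hQ.triadArea_ne_zero (i + 1)
  have h₂ := hQ.triadArea_ne_zero (i + 2)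
  have h₃ := hQ.triadArea_ne_zero (i - 1)
  rw [← neg_neg (homothetyRatio Q), ← edgeRatio_mul_edgeRatio_add_two i, edgeRatio, edgeRatio,
    quadDefect_add_two, fin_four_add_two_add_one]
  field_simp

theorem nextQuadrilateral_add_one_sub_sub_one (i : Fin 4) :
    nextQuadrilateral Q (i + 1) - nextQuadrilateral Q (i - 1) =
      Complex.I * (quadDefect Q i / (2 * triadArea Q (i + 1) * triadArea Q (i - 1)) : ℝ) *
        (Q (i + 2) - Q i) := by
  have h₀ : (triadArea Q i : ℂ) ≠ 0 := Complex.ofReal_ne_zero.2 (hQ.triadArea_ne_zero i)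
  have h₁ : (triadArea Q (i + 1) : ℂ) ≠ 0 := Complex.ofReal_ne_zero.2 (hQ.triadArea_ne_zero _)
  have h₃ : (triadArea Q (i - 1) : ℂ) ≠ 0 := Complex.ofReal_ne_zero.2 (hQ.triadArea_ne_zero _)
  have hS := signedArea_mul_sub_eq_add (Q i) (Q (i + 1)) (Q (i + 2)) (Q (i - 1))
  rw [← triadArea_add_one, ← triadArea_sub_one, ← triadArea] at hS
  rw [← sub_add_sub_cancel _ (nextQuadrilateral Q i), hQ.nextQuadrilateral_add_one_sub,
    hQ.nextQuadrilateral_sub_sub_one, edgeRatio, edgeRatio, quadDefect_sub_one, sub_add_cancel]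
  push_cast
  field_simp
  linear_combination -quadDefect Q i * hS

theorem norm_sq_nextQuadrilateral_diagonal_sub (i : Fin 4) :
    ‖nextQuadrilateral Q (i + 1) - nextQuadrilateral Q (i - 1) -
        homothetyRatio Q * (Q (i + 1) - Q (i - 1))‖ ^ 2 =
      homothetyRatio Q * (homothetyRatio Q - 1) * ‖Q (i + 1) - Q (i - 1)‖ ^ 2 := by
  have hr := hQ.homothetyRatio_mul_triadArea_mul_triadArea i
  have hD : 2 * (triadArea Q (i + 1) * triadArea Q (i - 1)) *
      (quadDefect Q i / (2 * triadArea Q (i + 1) * triadArea Q (i - 1))) = quadDefect Q i := by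
    rw [← mul_assoc, mul_div_cancel₀]
    exact mul_ne_zero (mul_ne_zero two_ne_zero (hQ.triadArea_ne_zero _)) (hQ.triadArea_ne_zero _)
  have hdiag := signedArea_mul_signedArea_mul_norm_sq_sub (Q i) (Q (i + 1)) (Q (i + 2)) (Q (i - 1))
  rw [← triadArea_add_one, ← triadArea_sub_one, ← triadArea_add_two, ← triadArea,
    ← quadDefect] at hdiag
  have harea : triadArea Q (i + 1) + triadArea Q (i - 1) =
      (conj (Q (i + 2) - Q i) * (Q (i - 1) - Q (i + 1))).im := by
    rw [triadArea_add_one, triadArea_sub_one]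
    simp only [signedArea, Complex.mul_im, Complex.conj_re, Complex.conj_im, Complex.sub_re,
      Complex.sub_im]
    ring
  rw [hQ.nextQuadrilateral_add_one_sub_sub_one]
  generalize quadDefect Q i / (2 * triadArea Q (i + 1) * triadArea Q (i - 1)) = k at *
  have hexp : ‖Complex.I * k * (Q (i + 2) - Q i) - homothetyRatio Q * (Q (i + 1) - Q (i - 1))‖ ^ 2 =
      k ^ 2 * ‖Q (i + 2) - Q i‖ ^ 2 + homothetyRatio Q ^ 2 * ‖Q (i + 1) - Q (i - 1)‖ ^ 2 +
        2 * homothetyRatio Q * k * (triadArea Q (i + 1) + triadArea Q (i - 1)) := by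
    rw [harea]
    simp only [Complex.sq_norm, Complex.normSq_apply, Complex.mul_re, Complex.mul_im,
      Complex.conj_re, Complex.conj_im, Complex.sub_re, Complex.sub_im, Complex.ofReal_re,
      Complex.ofReal_im, Complex.I_re, Complex.I_im]
    ring
  rw [hexp]
  refine mul_left_cancel₀ (mul_ne_zero (hQ.triadArea_ne_zero i) (hQ.triadArea_ne_zero (i + 2))) ?_
  rw [norm_sub_rev (Q (i - 1))] at hdiag
  linear_combination k ^ 2 * hdiag + (2 * k * (triadArea Q (i + 1) + triadArea Q (i - 1)) +
    ‖Q (i + 1) - Q (i - 1)‖ ^ 2) * hr - k ^ 2 * (triadArea Q (i + 1) + triadArea Q (i - 1)) * hD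

theorem two_triadArea_mul_nextQuadrilateral_sub (i : Fin 4) :
    2 * triadArea Q i * (nextQuadrilateral Q i - Q i) =
      Complex.I * ((Q (i + 1) - Q i) * (Q (i - 1) - Q i) * conj (Q (i - 1) - Q (i + 1))) := by
  have h := two_signedArea_mul_center_sub (self_mem_triadCircle (hQ.1 i))
    (add_one_mem_triadCircle (hQ.1 i)) (sub_one_mem_triadCircle (hQ.1 i))
  rwa [signedArea_rotate] at h

theorem two_triadArea_mul_nextQuadrilateral_nextQuadrilateral_sub (i : Fin 4) :
    2 * triadArea Q i * (nextQuadrilateral (nextQuadrilateral Q) i - nextQuadrilateral Q i) =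
      Complex.I * ((Q (i + 1) - Q i) * (Q (i - 1) - Q i) *
        conj (nextQuadrilateral Q (i + 1) - nextQuadrilateral Q (i - 1))) := by
  have h := hQ.nextQuadrilateral.two_triadArea_mul_nextQuadrilateral_sub i
  rw [hQ.triadArea_nextQuadrilateral, hQ.nextQuadrilateral_add_one_sub,
    ← neg_sub _ (nextQuadrilateral Q (i - 1)), hQ.nextQuadrilateral_sub_sub_one,
    ← neg_sub (nextQuadrilateral Q (i + 1)), map_neg] at h
  have hratio : (edgeRatio Q (i - 1) * edgeRatio Q i : ℂ) ≠ 0 :=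
    mul_ne_zero (Complex.ofReal_ne_zero.2 (hQ.edgeRatio_ne_zero _))
      (Complex.ofReal_ne_zero.2 (hQ.edgeRatio_ne_zero _))
  refine mul_left_cancel₀ hratio ?_
  push_cast at h
  linear_combination h - Complex.I * edgeRatio Q (i - 1) * edgeRatio Q i * (Q (i + 1) - Q i) *
    (Q (i - 1) - Q i) * conj (nextQuadrilateral Q (i + 1) - nextQuadrilateral Q (i - 1)) *
    Complex.I_sq

theorem norm_sq_nextQuadrilateral_nextQuadrilateral_sub (i : Fin 4) :
    ‖nextQuadrilateral (nextQuadrilateral Q) i - homothetyRatio Q * Q i -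
        (1 - homothetyRatio Q) * nextQuadrilateral Q i‖ ^ 2 =
      homothetyRatio Q * (homothetyRatio Q - 1) * (triadCircle Q i).radius ^ 2 := by
  set r := homothetyRatio Q
  set x := Complex.I * ((Q (i + 1) - Q i) * (Q (i - 1) - Q i))
  have ho : 2 * triadArea Q i * (nextQuadrilateral Q i - Q i) =
      -(x * conj (Q (i + 1) - Q (i - 1))) := by
    rw [hQ.two_triadArea_mul_nextQuadrilateral_sub, ← neg_sub (Q (i + 1)), map_neg]
    ring
  have hp : 2 * triadArea Q i * (nextQuadrilateral (nextQuadrilateral Q) i - r * Q i -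
      (1 - r) * nextQuadrilateral Q i) =
      x * conj (nextQuadrilateral Q (i + 1) - nextQuadrilateral Q (i - 1) -
        r * (Q (i + 1) - Q (i - 1))) := by
    rw [map_sub, map_mul, Complex.conj_ofReal]
    linear_combination r * ho +
      hQ.two_triadArea_mul_nextQuadrilateral_nextQuadrilateral_sub i
  have hS : ‖(2 * triadArea Q i : ℂ)‖ ^ 2 ≠ 0 := pow_ne_zero 2 <| norm_ne_zero_iff.2 <|
    mul_ne_zero two_ne_zero (Complex.ofReal_ne_zero.2 (hQ.triadArea_ne_zero i))
  refine mul_left_cancel₀ hS ?_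
  rw [← mem_sphere'.1 (self_mem_triadCircle (hQ.1 i)), dist_eq_norm, ← nextQuadrilateral,
    mul_left_comm, ← mul_pow, ← mul_pow, ← norm_mul, ← norm_mul, ho, hp, norm_neg, norm_mul x,
    norm_mul x, Complex.norm_conj, Complex.norm_conj, mul_pow, mul_pow,
    hQ.norm_sq_nextQuadrilateral_diagonal_sub, mul_left_comm]

end IsNoncyclicQuadrilateral

/-- The image of a circle under the map `z ↦ c * z + v`. -/
noncomputable def sphereImage (c v : ℂ) (s : Sphere ℂ) : Sphere ℂ :=
  ⟨c * s.center + v, ‖c‖ * s.radius⟩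

theorem mem_sphereImage {c v : ℂ} (hc : c ≠ 0) {s : Sphere ℂ} {z : ℂ} :
    c * z + v ∈ sphereImage c v s ↔ z ∈ s := by
  rw [mem_sphere, mem_sphere, sphereImage, dist_add_right, dist_eq_norm, ← mul_sub, norm_mul,
    ← dist_eq_norm, mul_right_inj' (norm_ne_zero_iff.2 hc)]

theorem image_mul_add_eq_sphereImage {c : ℂ} (hc : c ≠ 0) (v : ℂ) (s : Sphere ℂ) :
    (fun z => c * z + v) '' (s : Set ℂ) = (sphereImage c v s : Set ℂ) := by
  have hsurj : Function.Surjective fun z => c * z + v := fun z =>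
    ⟨c⁻¹ * (z - v), by simp only [mul_inv_cancel_left₀ hc, sub_add_cancel]⟩
  rw [← hsurj.image_preimage (sphereImage c v s)]
  congr 1
  ext z
  exact (mem_sphereImage hc).symm

section Similarity

variable {Q : Fin 4 → ℂ}

theorem triadArea_mul_add (c v : ℂ) (i : Fin 4) :
    triadArea (fun j => c * Q j + v) i = ‖c‖ ^ 2 * triadArea Q i := by
  rw [triadArea, triadArea, signedArea, signedArea, ← Complex.im_ofReal_mul, Complex.ofReal_pow,
    ← Complex.conj_mul']
  congr 1
  simp only [map_sub, map_add, map_mul]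
  ring

theorem triadCircle_mul_add {c : ℂ} (hc : c ≠ 0) (v : ℂ) {i : Fin 4}
    (h : AffineIndependent ℝ (triad Q i)) :
    triadCircle (fun j => c * Q j + v) i = sphereImage c v (triadCircle Q i) := by
  have h' : AffineIndependent ℝ (triad (fun j => c * Q j + v) i) := by
    rw [affineIndependent_triad_iff, triadArea_mul_add]
    exact mul_ne_zero (pow_ne_zero 2 (norm_ne_zero_iff.2 hc)) (affineIndependent_triad_iff.1 h)
  refine (eq_triadCircle h' fun j => ?_).symm
  have hj := (mem_sphereImage (v := v) hc).2 (triad_mem_triadCircle h j)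
  fin_cases j <;> exact hj

end Similarity

namespace IsNoncyclicQuadrilateral

variable {Q : Fin 4 → ℂ} (hQ : IsNoncyclicQuadrilateral Q)
include hQ

theorem homothetyShift_nextQuadrilateral :
    homothetyShift (nextQuadrilateral Q) = homothetyShift Q := by
  have hr : (homothetyRatio Q : ℂ) ≠ 0 := Complex.ofReal_ne_zero.2 hQ.homothetyRatio_ne_zero
  have hcircle := triadCircle_mul_add hr (homothetyShift Q) (hQ.1 0)
  rw [← funext hQ.nextQuadrilateral_nextQuadrilateral] at hcircle
  rw [homothetyShift, hQ.homothetyRatio_nextQuadrilateral, sub_eq_iff_eq_add']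
  exact congrArg Sphere.center hcircle

theorem homothetyRatio_generation (n : ℕ) :
    homothetyRatio (generation Q n) = homothetyRatio Q := by
  induction n with
  | zero => rfl
  | succ n ih =>
    rw [generation_succ,
      (hQ.generation n).homothetyRatio_nextQuadrilateral, ih]

theorem homothetyShift_generation (n : ℕ) :
    homothetyShift (generation Q n) = homothetyShift Q := by
  induction n with
  | zero => rfl
  | succ n ih =>
    rw [generation_succ,
      (hQ.generation n).homothetyShift_nextQuadrilateral, ih]

theorem generation_add_two (n : ℕ) (i : Fin 4) :
    generation Q (n + 2) i = homothetyRatio Q * generation Q n i + homothetyShift Q := by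
  rw [generation_succ, generation_succ,
    (hQ.generation n).nextQuadrilateral_nextQuadrilateral, hQ.homothetyRatio_generation,
    hQ.homothetyShift_generation]

theorem radius_triadCircle_nextQuadrilateral (hr : homothetyRatio Q = 1) (i : Fin 4) :
    (triadCircle (nextQuadrilateral Q) i).radius = (triadCircle Q i).radius ∧
      (triadCircle (nextQuadrilateral Q) i).radius = (triadCircle Q (i + 1)).radius := by
  have hperiod : nextQuadrilateral (nextQuadrilateral Q) i = Q i := by
    have h := hQ.norm_sq_nextQuadrilateral_nextQuadrilateral_sub i
    simpa [hr, sub_eq_zero] using h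
  have hpred := sub_one_mem_triadCircle (hQ.1 (i + 1))
  rw [add_sub_cancel_right] at hpred
  constructor
  · rw [← mem_sphere.1 (self_mem_triadCircle (hQ.nextQuadrilateral.1 i)), ← nextQuadrilateral,
      hperiod, ← mem_sphere'.1 (self_mem_triadCircle (hQ.1 i)), nextQuadrilateral]
  · rw [← mem_sphere.1 (add_one_mem_triadCircle (hQ.nextQuadrilateral.1 i)), ← nextQuadrilateral,
      hperiod, ← mem_sphere'.1 hpred, nextQuadrilateral]

theorem radius_triadCircle_generation (hr : homothetyRatio Q = 1) (n : ℕ) (i : Fin 4) :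
    (triadCircle (generation Q n) i).radius = (triadCircle Q 0).radius := by
  induction n with
  | zero =>
    refine eq_apply_zero_of_apply_add_one (f := fun i => (triadCircle Q i).radius) (fun i => ?_) i
    have h := hQ.radius_triadCircle_nextQuadrilateral hr i
    exact h.2.symm.trans h.1
  | succ n ih =>
    rw [generation_succ, ← ih]
    refine ((hQ.generation n).radius_triadCircle_nextQuadrilateral ?_ i).1
    rw [hQ.homothetyRatio_generation, hr]

theorem homothetyRatio_div_sub_one_pos (hr : homothetyRatio Q ≠ 1) :
    0 < homothetyRatio Q / (homothetyRatio Q - 1) := by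
  have hr₁ : homothetyRatio Q - 1 ≠ 0 := sub_ne_zero.2 hr
  have hR := triadCircle_radius_pos (hQ.1 0)
  have hnonneg : 0 ≤ homothetyRatio Q * (homothetyRatio Q - 1) := by
    refine nonneg_of_mul_nonneg_left (b := (triadCircle Q 0).radius ^ 2) ?_ (by positivity)
    rw [← hQ.norm_sq_nextQuadrilateral_nextQuadrilateral_sub]
    positivity
  rw [← mul_div_mul_right _ _ hr₁]
  exact div_pos (hnonneg.lt_of_ne' (mul_ne_zero hQ.homothetyRatio_ne_zero hr₁))
    (mul_self_pos.2 hr₁)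

theorem dist_homothetyShift_div (hr : homothetyRatio Q ≠ 1) (i : Fin 4) :
    dist (homothetyShift Q / (1 - homothetyRatio Q)) (triadCircle Q i).center =
      √(homothetyRatio Q / (homothetyRatio Q - 1)) * (triadCircle Q i).radius := by
  have hr₁ : homothetyRatio Q - 1 ≠ 0 := sub_ne_zero.2 hr
  have hr₁' : (1 - homothetyRatio Q : ℂ) ≠ 0 := sub_ne_zero.2 (mod_cast hr.symm)
  have hfactor : homothetyShift Q - (1 - homothetyRatio Q) * nextQuadrilateral Q i =
      ((1 - homothetyRatio Q : ℝ) : ℂ) *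
        (homothetyShift Q / (1 - homothetyRatio Q) - nextQuadrilateral Q i) := by
    push_cast
    rw [mul_sub, mul_div_cancel₀ _ hr₁']
  have h := hQ.norm_sq_nextQuadrilateral_nextQuadrilateral_sub i
  rw [hQ.nextQuadrilateral_nextQuadrilateral, add_sub_cancel_left, hfactor, norm_mul, mul_pow,
    Complex.norm_real, Real.norm_eq_abs, sq_abs, ← dist_eq_norm, nextQuadrilateral] at h
  refine (pow_left_inj₀ dist_nonneg
    (mul_nonneg (Real.sqrt_nonneg _) (triadCircle_radius_pos (hQ.1 i)).le) two_ne_zero).1 ?_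
  rw [mul_pow, Real.sq_sqrt (hQ.homothetyRatio_div_sub_one_pos hr).le]
  refine mul_left_cancel₀ (pow_ne_zero 2 hr₁) ?_
  rw [sub_sq_comm, h]
  field_simp
  ring

end IsNoncyclicQuadrilateral

theorem infty_mem_circleOfSimilitude {s t : Sphere ℂ} :
    OnePoint.infty ∈ circleOfSimilitude s t ↔ s.radius = t.radius := by
  simp [circleOfSimilitude, OnePoint.infty_ne_coe]

theorem coe_mem_circleOfSimilitude {s t : Sphere ℂ} (hs : s.radius ≠ 0) (ht : t.radius ≠ 0)
    {z : ℂ} :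
    (z : OnePoint ℂ) ∈ circleOfSimilitude s t ↔
      z ≠ s.center ∧ dist z s.center * t.radius = dist z t.center * s.radius := by
  have hmem : (z : OnePoint ℂ) ∈ circleOfSimilitude s t ↔
      dist z s.center / dist z t.center = s.radius / t.radius := by
    simp [circleOfSimilitude]
  rw [hmem]
  constructor
  · intro h
    have hne : dist z s.center ≠ 0 ∧ dist z t.center ≠ 0 :=
      div_ne_zero_iff.1 (h ▸ div_ne_zero hs ht)
    rw [div_eq_div_iff hne.2 ht, mul_comm s.radius] at h
    exact ⟨dist_ne_zero.1 hne.1, h⟩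
  · rintro ⟨hz, h⟩
    have hzt : dist z t.center ≠ 0 := fun h0 => mul_ne_zero (dist_ne_zero.2 hz) ht (by
      rw [h, h0, zero_mul])
    rw [div_eq_div_iff hzt ht, h, mul_comm]

theorem exists_dist_eq_mul_radius {ι : Type*} {s : ι → Sphere ℂ} (hs : ∀ i, (s i).radius ≠ 0)
    {i₀ : ι} {z : ℂ} (hz : ∀ i, (z : OnePoint ℂ) ∈ circleOfSimilitude (s i₀) (s i)) :
    ∃ κ : ℝ, ∀ i, dist z (s i).center = κ * (s i).radius := by
  refine ⟨dist z (s i₀).center / (s i₀).radius, fun i => ?_⟩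
  rw [div_mul_eq_mul_div, ((coe_mem_circleOfSimilitude (hs i₀) (hs i)).1 (hz i)).2,
    mul_div_cancel_right₀ _ (hs i₀)]

theorem mem_circleOfSimilitude_self {s t : Sphere ℂ} (hs : s.radius ≠ 0) (ht : t.radius ≠ 0)
    {P : OnePoint ℂ} (hP : P ∈ circleOfSimilitude s t) : P ∈ circleOfSimilitude s s := by
  induction P using OnePoint.rec with
  | infty => exact infty_mem_circleOfSimilitude.2 rfl
  | coe z =>
    rw [coe_mem_circleOfSimilitude hs ht] at hP
    exact (coe_mem_circleOfSimilitude hs hs).2 ⟨hP.1, rfl⟩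

theorem isSpiralCenter_of_mem_circleOfSimilitude {s t : Sphere ℂ} (hs : s.radius ≠ 0)
    (ht : t.radius ≠ 0) {P : OnePoint ℂ} (hP : P ∈ circleOfSimilitude s t) :
    IsSpiralCenter P s t := by
  induction P using OnePoint.rec with
  | infty =>
    refine Or.inr ⟨rfl, t.center - s.center, ?_⟩
    have himage : sphereImage 1 (t.center - s.center) s = t := by
      ext1 <;> simp [sphereImage, infty_mem_circleOfSimilitude.1 hP]
    simpa only [one_mul, himage] using
      image_mul_add_eq_sphereImage one_ne_zero (t.center - s.center) s
  | coe w =>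
    obtain ⟨hws, hdist⟩ := (coe_mem_circleOfSimilitude hs ht).1 hP
    have hwt : w ≠ t.center := fun h => mul_ne_zero (dist_ne_zero.2 hws) ht (by
      rw [hdist, h, dist_self, zero_mul])
    have hne : s.center - w ≠ 0 := sub_ne_zero.2 hws.symm
    set c := (t.center - w) / (s.center - w)
    have hc : c ≠ 0 := div_ne_zero (sub_ne_zero.2 hwt.symm) hne
    have himage : sphereImage c (w - c * w) s = t := by
      ext1
      · rw [sphereImage, ← add_sub_assoc, add_sub_right_comm, ← mul_sub, div_mul_cancel₀ _ hne,
          sub_add_cancel]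
      · change ‖c‖ * s.radius = t.radius
        rw [norm_div, ← dist_eq_norm', ← dist_eq_norm', div_mul_eq_mul_div, ← hdist,
          mul_div_cancel_left₀ _ (dist_ne_zero.2 hws)]
    have hmap : spiralSimilarity w c = fun z => c * z + (w - c * w) := by
      funext z
      rw [spiralSimilarity]
      ring
    exact Or.inl ⟨w, c, rfl, hc, by rw [hmap, image_mul_add_eq_sphereImage hc, himage]⟩

section Uniqueness

variable {E ι : Type*} [NormedAddCommGroup E] [InnerProductSpace ℝ E] {o : ι → E}

theorem eq_zero_of_inner_sub_eq_const (ho : affineSpan ℝ (Set.range o) = ⊤) {a x : E} {k : ℝ}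
    (hx : ∀ i, ⟪x, a - o i⟫ = k) : x = 0 := by
  have hspan : vectorSpan ℝ (Set.range o) ≤ (ℝ ∙ x)ᗮ := by
    rw [vectorSpan_def, Submodule.span_le]
    rintro _ ⟨_, ⟨i, rfl⟩, _, ⟨j, rfl⟩, rfl⟩
    refine Submodule.mem_orthogonal_singleton_iff_inner_right.2 ?_
    change ⟪x, o i - o j⟫ = 0
    rw [← sub_sub_sub_cancel_left _ _ a, inner_sub_right, hx, hx, sub_self]
  rw [AffineSubspace.vectorSpan_eq_top_of_affineSpan_eq_top ℝ E E ho] at hspan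
  exact inner_self_eq_zero.1
    (Submodule.mem_orthogonal_singleton_iff_inner_right.1 (hspan Submodule.mem_top))

theorem dist_sq_eq_dist_sq_add (a b c : E) :
    dist b c ^ 2 = dist a c ^ 2 + 2 * ⟪b - a, a - c⟫ + dist a b ^ 2 := by
  rw [dist_eq_norm, dist_eq_norm, dist_eq_norm', ← sub_add_sub_cancel b a c, norm_add_sq_real]
  ring

theorem eq_of_dist_sq_sub_dist_sq_eq_const (ho : affineSpan ℝ (Set.range o) = ⊤) {a b : E} {k : ℝ}
    (h : ∀ i, dist b (o i) ^ 2 - dist a (o i) ^ 2 = k) : b = a := by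
  refine sub_eq_zero.1 (eq_zero_of_inner_sub_eq_const (a := a) (k := (k - dist a b ^ 2) / 2) ho
    fun i => ?_)
  linarith [h i, dist_sq_eq_dist_sq_add a b (o i)]

theorem eq_or_eq_of_dist_eq_mul (ho : affineSpan ℝ (Set.range o) = ⊤) {a b c : E} {κ τ : ℝ}
    (hb : ∀ i, dist b (o i) = κ * dist a (o i)) (hc : ∀ i, dist c (o i) = τ * dist a (o i))
    (hba : b ≠ a) : c = a ∨ c = b := by
  have hκ : κ ^ 2 - 1 ≠ 0 := fun hκ => hba <| eq_of_dist_sq_sub_dist_sq_eq_const (k := 0) ho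
    fun i => by rw [hb]; linear_combination dist a (o i) ^ 2 * hκ
  have hinner (i) : 2 * ⟪(κ ^ 2 - 1) • (c - a) - (τ ^ 2 - 1) • (b - a), a - o i⟫ =
      (τ ^ 2 - 1) * dist a b ^ 2 - (κ ^ 2 - 1) * dist a c ^ 2 := by
    have hbi := dist_sq_eq_dist_sq_add a b (o i)
    have hci := dist_sq_eq_dist_sq_add a c (o i)
    rw [hb] at hbi
    rw [hc] at hci
    rw [inner_sub_left, real_inner_smul_left, real_inner_smul_left]
    linear_combination (τ ^ 2 - 1) * hbi - (κ ^ 2 - 1) * hci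
  have hx : (κ ^ 2 - 1) • (c - a) - (τ ^ 2 - 1) • (b - a) = 0 :=
    eq_zero_of_inner_sub_eq_const ho fun i => eq_div_of_mul_eq two_ne_zero
      ((mul_comm _ _).trans (hinner i))
  obtain ⟨m, hm⟩ : ∃ m, τ ^ 2 - 1 = (κ ^ 2 - 1) * m := ⟨_, (mul_div_cancel₀ _ hκ).symm⟩
  rw [hm, mul_smul, ← smul_sub, smul_eq_zero_iff_right hκ, sub_eq_zero] at hx
  obtain ⟨_, i, rfl⟩ := AffineSubspace.nonempty_of_affineSpan_eq_top ℝ E E ho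
  have hdist : (κ ^ 2 - 1) * dist a b ^ 2 * (m * (1 - m)) = 0 := by
    have h := hinner i
    rw [hx, hm, mul_smul, sub_self, inner_zero_left, dist_eq_norm' a c, hx, norm_smul,
      ← dist_eq_norm', mul_pow, Real.norm_eq_abs, sq_abs] at h
    linear_combination -h
  rcases mul_eq_zero.1 ((mul_eq_zero_iff_left
    (mul_ne_zero hκ (pow_ne_zero 2 (dist_ne_zero.2 hba.symm)))).1 hdist) with hm₀ | hm₁
  · exact Or.inl (sub_eq_zero.1 (by rw [hx, hm₀, zero_smul]))
  · rw [← sub_eq_zero.1 hm₁, one_smul, sub_left_inj] at hx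
    exact Or.inr hx

end Uniqueness

theorem eq_of_mem_circleOfSimilitude {ι : Type*} {s : ι → Sphere ℂ}
    (hs : ∀ i, (s i).radius ≠ 0) (hspan : affineSpan ℝ (Set.range fun i => (s i).center) = ⊤)
    {a : ℂ} (ha : ∀ i, a ∈ s i) {i₀ : ι} {P W : OnePoint ℂ} (hPa : P ≠ a) (hWa : W ≠ a)
    (hP : ∀ i, P ∈ circleOfSimilitude (s i₀) (s i))
    (hW : ∀ i, W ∈ circleOfSimilitude (s i₀) (s i)) : P = W := by
  have hfinite {z : ℂ} (hz : ∀ i, (z : OnePoint ℂ) ∈ circleOfSimilitude (s i₀) (s i)) :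
      ∃ κ : ℝ, ∀ i, dist z (s i).center = κ * dist a (s i).center := by
    simpa only [mem_sphere.1 (ha _)] using exists_dist_eq_mul_radius hs hz
  have hinfty (h : ∀ i, OnePoint.infty ∈ circleOfSimilitude (s i₀) (s i)) {z : ℂ}
      (hz : ∀ i, (z : OnePoint ℂ) ∈ circleOfSimilitude (s i₀) (s i)) : z = a := by
    obtain ⟨κ, hκ⟩ := hfinite hz
    refine eq_of_dist_sq_sub_dist_sq_eq_const (k := (κ ^ 2 - 1) * (s i₀).radius ^ 2) hspan
      fun i => ?_
    rw [hκ, mem_sphere.1 (ha i), infty_mem_circleOfSimilitude.1 (h i)]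
    ring
  induction P using OnePoint.rec with
  | infty =>
    induction W using OnePoint.rec with
    | infty => rfl
    | coe w => exact absurd (congrArg _ (hinfty hP hW)) hWa
  | coe z =>
    induction W using OnePoint.rec with
    | infty => exact absurd (congrArg _ (hinfty hW hP)) hPa
    | coe w =>
      obtain ⟨κ, hκ⟩ := hfinite hW
      obtain ⟨τ, hτ⟩ := hfinite hP
      have hwa : w ≠ a := fun h => hWa (congrArg _ h)
      have hza : z ≠ a := fun h => hPa (congrArg _ h)
      rw [(eq_or_eq_of_dist_eq_mul hspan hκ hτ hwa).resolve_left hza]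

theorem coe_mem_circleOfSimilitude_of_dist_eq_mul_radius {s t : Sphere ℂ} (hs : s.radius ≠ 0)
    (ht : t.radius ≠ 0) {z : ℂ} {κ : ℝ} (hκ : κ ≠ 0) (hzs : dist z s.center = κ * s.radius)
    (hzt : dist z t.center = κ * t.radius) : (z : OnePoint ℂ) ∈ circleOfSimilitude s t := by
  refine (coe_mem_circleOfSimilitude hs ht).2 ⟨dist_ne_zero.1 (hzs ▸ mul_ne_zero hκ hs), ?_⟩
  rw [hzs, hzt, mul_right_comm]

open Classical in
/-- The isoptic point of a quadrilateral: the fixed point in the extended plane of the homothety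
that takes `Q` to the quadrilateral two generations later, which is `∞` if that homothety is a
translation. -/
noncomputable def isopticPoint (Q : Fin 4 → ℂ) : OnePoint ℂ :=
  if homothetyRatio Q = 1 then OnePoint.infty
  else ((homothetyShift Q / (1 - homothetyRatio Q) : ℂ) : OnePoint ℂ)

namespace IsNoncyclicQuadrilateral

variable {Q : Fin 4 → ℂ} (hQ : IsNoncyclicQuadrilateral Q)
include hQ

theorem isopticPoint_mem_circleOfSimilitude (k l : ℕ) (i j : Fin 4) :
    isopticPoint Q ∈
      circleOfSimilitude (triadCircle (generation Q k) i) (triadCircle (generation Q l) j) := by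
  by_cases hr : homothetyRatio Q = 1
  · rw [isopticPoint, if_pos hr, infty_mem_circleOfSimilitude,
      hQ.radius_triadCircle_generation hr, hQ.radius_triadCircle_generation hr]
  have hdist (n : ℕ) (i : Fin 4) := (hQ.generation n).dist_homothetyShift_div
    ((hQ.homothetyRatio_generation n).trans_ne hr) i
  simp only [hQ.homothetyRatio_generation, hQ.homothetyShift_generation] at hdist
  rw [isopticPoint, if_neg hr]
  exact coe_mem_circleOfSimilitude_of_dist_eq_mul_radius
    (triadCircle_radius_pos ((hQ.generation k).1 i)).ne'
    (triadCircle_radius_pos ((hQ.generation l).1 j)).ne'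
    (Real.sqrt_pos.2 (hQ.homothetyRatio_div_sub_one_pos hr)).ne' (hdist k i) (hdist l j)

theorem isopticPoint_ne (i : Fin 4) : isopticPoint Q ≠ (Q i : OnePoint ℂ) := by
  by_cases hr : homothetyRatio Q = 1
  · rw [isopticPoint, if_pos hr]
    exact OnePoint.infty_ne_coe _
  rw [isopticPoint, if_neg hr, Ne, OnePoint.coe_eq_coe]
  intro h
  have hdist := hQ.dist_homothetyShift_div hr i
  rw [h, mem_sphere.1 (self_mem_triadCircle (hQ.1 i)), eq_comm,
    mul_eq_right₀ (triadCircle_radius_pos (hQ.1 i)).ne', Real.sqrt_eq_one,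
    div_eq_one_iff_eq (sub_ne_zero.2 hr)] at hdist
  linarith

theorem isSecondIntersection_iff {P : OnePoint ℂ} :
    IsSecondIntersection Q P ↔ P = isopticPoint Q := by
  have hR (i : Fin 4) : (triadCircle Q i).radius ≠ 0 := (triadCircle_radius_pos (hQ.1 i)).ne'
  have hW := hQ.isopticPoint_mem_circleOfSimilitude 0 0 0
  constructor
  · rintro ⟨hP, hP₁, hP₃⟩
    let s : Fin 3 → Sphere ℂ := ![triadCircle Q 3, triadCircle Q 0, triadCircle Q 1]
    have hcenter : (fun j => (s j).center) = triad (nextQuadrilateral Q) 0 := by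
      ext1 j
      fin_cases j <;> rfl
    have hspan : affineSpan ℝ (Set.range fun j => (s j).center) = ⊤ := by
      rw [hcenter, (hQ.nextQuadrilateral.1 0).affineSpan_eq_top_iff_card_eq_finrank_add_one,
        Complex.finrank_real_complex, Fintype.card_fin]
    refine eq_of_mem_circleOfSimilitude (s := s) (i₀ := 1) (a := Q 0)
      (fun j => ?_) hspan (fun j => ?_) hP (hQ.isopticPoint_ne 0) (fun j => ?_) fun j => ?_
    · fin_cases j <;> exact hR _
    · fin_cases j
      exacts [add_one_mem_triadCircle (hQ.1 3), self_mem_triadCircle (hQ.1 0),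
        sub_one_mem_triadCircle (hQ.1 1)]
    · fin_cases j
      exacts [hP₃, mem_circleOfSimilitude_self (hR 0) (hR 1) hP₁, hP₁]
    · fin_cases j <;> exact hW _
  · rintro rfl
    exact ⟨hQ.isopticPoint_ne 0, hW 1, hW 3⟩

theorem isopticPoint_eq_coe_iff {w : ℂ} :
    isopticPoint Q = w ↔ ∃ r : ℝ, r ≠ 1 ∧ ∀ (n : ℕ) (i : Fin 4),
      generation Q (n + 2) i = spiralSimilarity w r (generation Q n i) := by
  have hdiv {r : ℝ} (hr : r ≠ 1) {v : ℂ} : v / (1 - r) = w ↔ v = w * (1 - r) :=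
    div_eq_iff (sub_ne_zero.2 (mod_cast hr.symm))
  simp only [hQ.generation_add_two, spiralSimilarity]
  constructor
  · intro h
    have hr : homothetyRatio Q ≠ 1 := fun hr => OnePoint.infty_ne_coe w (by
      rw [← h, isopticPoint, if_pos hr])
    rw [isopticPoint, if_neg hr, OnePoint.coe_eq_coe, hdiv hr] at h
    exact ⟨homothetyRatio Q, hr, fun n i => by linear_combination h⟩
  · rintro ⟨r, hr, h⟩
    have h₀ : homothetyRatio Q * Q 0 + homothetyShift Q = w + r * (Q 0 - w) := h 0 0
    have h₁ : homothetyRatio Q * Q 1 + homothetyShift Q = w + r * (Q 1 - w) := h 0 1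
    have hne : Q 0 ≠ Q 1 := (hQ.1 1).injective.ne (show (0 : Fin 3) ≠ 1 by decide)
    obtain rfl : homothetyRatio Q = r := Complex.ofReal_injective <|
      mul_right_cancel₀ (sub_ne_zero.2 hne) (by linear_combination h₀ - h₁)
    rw [isopticPoint, if_neg hr, OnePoint.coe_eq_coe, hdiv hr]
    linear_combination h₀

end IsNoncyclicQuadrilateral

end

theorem mainTheorem8 (Q : Fin 4 → ℂ) (hQ : IsNoncyclicQuadrilateral Q) :
    (∀ n : ℕ, IsNoncyclicQuadrilateral (generation Q n)) ∧
    ∃ W : OnePoint ℂ,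
      (∀ P : OnePoint ℂ, IsSecondIntersection Q P ↔ P = W) ∧
      (∀ w : ℂ, W = (w : OnePoint ℂ) ↔
        ∃ r : ℝ, r ≠ 1 ∧ ∀ (n : ℕ) (i : Fin 4),
          generation Q (n + 2) i = spiralSimilarity w (r : ℂ) (generation Q n i)) ∧
      (∀ (k l : ℕ) (i j : Fin 4),
        W ∈ circleOfSimilitude (triadCircle (generation Q k) i) (triadCircle (generation Q l) j) ∧
        IsSpiralCenter W (triadCircle (generation Q k) i) (triadCircle (generation Q l) j)) := by
  refine ⟨hQ.generation, isopticPoint Q, fun P => hQ.isSecondIntersection_iff,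
    fun w => hQ.isopticPoint_eq_coe_iff, fun k l i j => ?_⟩
  have hW := hQ.isopticPoint_mem_circleOfSimilitude k l i j
  exact ⟨hW, isSpiralCenter_of_mem_circleOfSimilitude
    (triadCircle_radius_pos ((hQ.generation k).1 i)).ne'
    (triadCircle_radius_pos ((hQ.generation l).1 j)).ne' hW⟩
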